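/- Let $G_1,\dots,G_n$ be density matrices, i.e. $n\times n$ complex positive semidefinite matrices of trace $1$, and let $G_i=H_i^*H_i$, where $H_1,\dots,H_n$ are $n\times n$ complex matrices. For a square matrix $X$ put $|X|=(X^*X)^{1/2}$. Let $a_{st}$ ($1\le s,t\le n$) denote any one of the following three arrays: $$a_{st}=\operatorname{tr}(H_s^*H_t),\qquad a_{st}=\operatorname{Re}\operatorname{tr}(H_s^*H_t),\qquad a_{st}=\operatorname{tr}|H_s^*H_t| .$$ Then for all indices $1\le i<p<q\le n$ we have $|a_{pq}|\le 1$ (so that all the square roots below are of nonnegative numbers), $$\big|\,|a_{ip}|-|a_{iq}|\,\big|\le\sqrt{1-|a_{pq}|^2}\le\sqrt2\,\sqrt{1-|a_{pq}|},$$ and, for every real $k\ge 2$, $$\big|\,|a_{ip}|^k-|a_{iq}|^k\,\big|\le\sqrt{1-|a_{pq}|^k}.$$ -/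

import Mathlib

open scoped Matrix MatrixOrder ComplexOrder

/-- A density matrix: a positive semidefinite complex matrix of trace `1`. -/
structure IsDensityMatrix {n : ℕ} (G : Matrix (Fin n) (Fin n) ℂ) : Prop where
  posSemidef : G.PosSemidef
  trace_eq_one : G.trace = 1

/-- The absolute value `|X| = (Xᴴ X)^{1/2}` of a square complex matrix; `CFC.sqrt` of a positive
semidefinite matrix is its unique positive semidefinite square root. -/
noncomputable def matrixAbs {n : ℕ} (X : Matrix (Fin n) (Fin n) ℂ) :
    Matrix (Fin n) (Fin n) ℂ :=
  CFC.sqrt (Xᴴ * X)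

/-- The inequalities between the entries above the diagonal in every `3 × 3` principal submatrix
(rows and columns `i < p < q`) of the array `a`. The bound `‖a p q‖ ≤ 1` records that all the
square roots are taken of nonnegative numbers. -/
def EntryInequalities {n : ℕ} (a : Fin n → Fin n → ℂ) : Prop :=
  ∀ i p q : Fin n, i < p → p < q →
    ‖a p q‖ ≤ 1 ∧
    |‖a i p‖ - ‖a i q‖| ≤ √(1 - ‖a p q‖ ^ 2) ∧
    √(1 - ‖a p q‖ ^ 2) ≤ √2 * √(1 - ‖a p q‖) ∧
    ∀ k : ℝ, 2 ≤ k → |‖a i p‖ ^ k - ‖a i q‖ ^ k| ≤ √(1 - ‖a p q‖ ^ k)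

/-! Each array is reduced to the angle condition `z ≤ x * y + √(1 - x ^ 2) * √(1 - y ^ 2)`, that is
`cos γ ≤ cos (α - β)`, for the moduli `x, y, z` of the entries `ip, iq, pq`. It gives `|x ^ 2 - y ^
2| = |sin (α - β)| * sin (α + β) ≤ sin γ`. It also survives `m`-th powers with `m ≥ 1`
(`rpow_le_of_le_mul_add_sqrt`), and `m = k / 2` settles every `k ≥ 2`. The trace and its real part
are inner products of unit vectors, where the condition is classical. The trace norm is the maximum
of `|tr (U X)|` over unitary `U`: rotating the `H`s makes the `pq` entry and the larger of the other
two exact inner products, while the smaller one can only drop, which widens the difference to be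
bounded. -/

/-- Monotonicity, in the weighted arithmetic-mean form, behind `rpow_le_of_le_mul_add_sqrt`. -/
theorem two_mul_rpow_sub_le {x y α β m μ : ℝ} (hx : 0 ≤ x) (hy : 0 ≤ y) (hα : 0 ≤ α) (hβ : 0 ≤ β)
    (hm : 1 ≤ m) (hμ : 0 < μ) :
    2 * ((x * y + α * β) ^ m - (x * y) ^ m) ≤
      μ * ((x ^ 2 + α ^ 2) ^ m - (x ^ 2) ^ m) + μ⁻¹ * ((y ^ 2 + β ^ 2) ^ m - (y ^ 2) ^ m) := by
  have power (a b t : ℝ) : HasDerivAt (fun t : ℝ => (a + t * b) ^ m)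
      (b * m * (a + t * b) ^ (m - 1)) t :=
    (((hasDerivAt_id t).mul_const b).const_add a).rpow_const (Or.inr hm) |>.congr_deriv (by simp)
  -- The parameter `t` switches on the `α, β` terms; the claim is `E 0 ≤ E 1`.
  let E : ℝ → ℝ := fun t => μ * (x ^ 2 + t * α ^ 2) ^ m + μ⁻¹ * (y ^ 2 + t * β ^ 2) ^ m
    - 2 * (x * y + t * (α * β)) ^ m
  have hE (t : ℝ) := (((power (x ^ 2) (α ^ 2) t).const_mul μ).add
    ((power (y ^ 2) (β ^ 2) t).const_mul μ⁻¹)).sub ((power (x * y) (α * β) t).const_mul 2)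
  have mono : MonotoneOn E (Set.Icc 0 1) := by
    refine monotoneOn_of_hasDerivWithinAt_nonneg (convex_Icc 0 1)
      (fun t _ => (hE t).continuousAt.continuousWithinAt)
      (fun t _ => (hE t).hasDerivWithinAt) ?_
    intro t ht
    rw [interior_Icc] at ht
    have ht0 : 0 ≤ t := ht.1.le
    set A := x ^ 2 + t * α ^ 2 with hA
    set B := y ^ 2 + t * β ^ 2 with hB
    set C := x * y + t * (α * β) with hC
    have hA0 : 0 ≤ A := by positivity
    have hB0 : 0 ≤ B := by positivity
    have hC0 : 0 ≤ C := by positivity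
    -- Cauchy–Schwarz for `(x, √t α)` and `(y, √t β)`.
    have hCAB : C ≤ √A * √B := by
      rw [← Real.sqrt_mul hA0]
      apply Real.le_sqrt_of_sq_le
      have : A * B - C ^ 2 = t * (x * β - y * α) ^ 2 := by rw [hA, hB, hC]; ring
      nlinarith [mul_nonneg ht0 (sq_nonneg (x * β - y * α))]
    have hC' : C ^ (m - 1) ≤ √A ^ (m - 1) * √B ^ (m - 1) := by
      rw [← Real.mul_rpow (by positivity) (by positivity)]
      exact Real.rpow_le_rpow hC0 hCAB (by linarith)
    have sq_pow (u : ℝ) (hu : 0 ≤ u) : u ^ (m - 1) = (√u ^ (m - 1)) ^ 2 := by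
      rw [sq, ← Real.mul_rpow (Real.sqrt_nonneg _) (Real.sqrt_nonneg _), Real.mul_self_sqrt hu]
    rw [sq_pow A hA0, sq_pow B hB0]
    set a := √A ^ (m - 1)
    set b := √B ^ (m - 1)
    have h1 : α * β * C ^ (m - 1) ≤ α * β * (a * b) := by gcongr
    have hs : √μ ^ 2 = μ := Real.sq_sqrt hμ.le
    have hs0 : 0 < √μ := Real.sqrt_pos.2 hμ
    have h2 : (√μ * (α * a) - (√μ)⁻¹ * (β * b)) ^ 2 =
        μ * (α * a) ^ 2 + μ⁻¹ * (β * b) ^ 2 - 2 * (α * a) * (β * b) := by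
      rw [sub_sq, mul_pow √μ, mul_pow (√μ)⁻¹, inv_pow, hs]
      field_simp
      ring
    have h3 : 0 ≤ μ * (α * a) ^ 2 + μ⁻¹ * (β * b) ^ 2 - 2 * (α * β * C ^ (m - 1)) := by
      nlinarith [sq_nonneg (√μ * (α * a) - (√μ)⁻¹ * (β * b))]
    have h4 := mul_nonneg (by linarith : (0 : ℝ) ≤ m) h3
    linarith
  have := mono (Set.left_mem_Icc.2 zero_le_one) (Set.right_mem_Icc.2 zero_le_one) zero_le_one
  simp only [E, zero_mul, one_mul, add_zero] at this
  linarith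

/-- Hadamard powers with exponent `m ≥ 1` preserve positivity of `3 × 3` correlation matrices
with nonnegative entries. -/
theorem rpow_le_of_le_mul_add_sqrt {x y z m : ℝ} (hx : 0 ≤ x) (hy : 0 ≤ y) (hz : 0 ≤ z)
    (hx1 : x ≤ 1) (hy1 : y ≤ 1) (hm : 1 ≤ m)
    (h : z ≤ x * y + √(1 - x ^ 2) * √(1 - y ^ 2)) :
    z ^ m ≤ x ^ m * y ^ m + √(1 - (x ^ m) ^ 2) * √(1 - (y ^ m) ^ 2) := by
  rcases hx1.eq_or_lt with rfl | hx1
  · simpa using Real.rpow_le_rpow hz (by simpa using h) (by linarith)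
  rcases hy1.eq_or_lt with rfl | hy1
  · simpa using Real.rpow_le_rpow hz (by simpa using h) (by linarith)
  have hm0 : 0 < m := by linarith
  have sq_pow (u : ℝ) (hu : 0 ≤ u) : (u ^ 2) ^ m = (u ^ m) ^ 2 := by
    rw [sq, Real.mul_rpow hu hu, sq]
  have pos (u : ℝ) (hu : 0 ≤ u) (hu1 : u < 1) : 0 < 1 - (u ^ m) ^ 2 := by
    have := Real.rpow_lt_one hu hu1 hm0
    nlinarith [Real.rpow_nonneg hu m]
  have hp := Real.sqrt_pos.2 (pos x hx hx1)
  have hq := Real.sqrt_pos.2 (pos y hy hy1)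
  have hp2 := Real.sq_sqrt (pos x hx hx1).le
  have hq2 := Real.sq_sqrt (pos y hy hy1).le
  -- The weight `μ = q / p` is the equality case of the weighted mean: `μ p² + μ⁻¹ q² = 2 p q`.
  have key := two_mul_rpow_sub_le (m := m) hx hy (Real.sqrt_nonneg (1 - x ^ 2))
    (Real.sqrt_nonneg (1 - y ^ 2)) hm (div_pos hq hp)
  rw [Real.sq_sqrt (by nlinarith), Real.sq_sqrt (by nlinarith), add_sub_cancel, add_sub_cancel,
    Real.one_rpow, sq_pow x hx, sq_pow y hy, Real.mul_rpow hx hy] at key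
  have hz' := Real.rpow_le_rpow hz h hm0.le
  generalize √(1 - (x ^ m) ^ 2) = p at *
  generalize √(1 - (y ^ m) ^ 2) = q at *
  rw [← hp2, ← hq2] at key
  have : q / p * p ^ 2 + (q / p)⁻¹ * q ^ 2 = 2 * (p * q) := by field_simp; ring
  linarith

/-- For `x = cos α`, `y = cos β`, the quantity `x * t - y * s` below is `sin (β - α)`, and `x ^ 2 -
y ^ 2` is its product with `sin (α + β)`. That second factor is at most both `x + y` and `1`, which
gives the two bounds. -/
theorem abs_sub_le_and_abs_sq_sub_sq_le {x y z : ℝ} (hx : 0 ≤ x) (hy : 0 ≤ y) (hz : 0 ≤ z)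
    (hx1 : x ≤ 1) (hy1 : y ≤ 1) (h : z ≤ x * y + √(1 - x ^ 2) * √(1 - y ^ 2)) :
    |x - y| ≤ √(1 - z ^ 2) ∧ |x ^ 2 - y ^ 2| ≤ √(1 - z ^ 2) := by
  have hs0 := Real.sqrt_nonneg (1 - x ^ 2)
  have ht0 := Real.sqrt_nonneg (1 - y ^ 2)
  have hs2 := Real.sq_sqrt (show 0 ≤ 1 - x ^ 2 by nlinarith)
  have ht2 := Real.sq_sqrt (show 0 ≤ 1 - y ^ 2 by nlinarith)
  generalize √(1 - x ^ 2) = s at *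
  generalize √(1 - y ^ 2) = t at *
  have hs1 : s ≤ 1 := by nlinarith
  have ht1 : t ≤ 1 := by nlinarith
  have hw : |x * t - y * s| ≤ √(1 - z ^ 2) := by
    apply Real.le_sqrt_of_sq_le
    rw [sq_abs]
    have : z ^ 2 ≤ (x * y + s * t) ^ 2 := by gcongr
    have : (x * y + s * t) ^ 2 + (x * t - y * s) ^ 2 = (x ^ 2 + s ^ 2) * (y ^ 2 + t ^ 2) := by ring
    rw [hs2, ht2] at this
    linarith
  have fac : x ^ 2 - y ^ 2 = (x * t - y * s) * (x * t + y * s) := by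
    have : (x * t - y * s) * (x * t + y * s) = x ^ 2 * t ^ 2 - y ^ 2 * s ^ 2 := by ring
    rw [this, hs2, ht2]; ring
  have hu0 : 0 ≤ x * t + y * s := by positivity
  constructor
  · refine le_trans ?_ hw
    rcases (add_nonneg hx hy).eq_or_lt with h0 | h0
    · have hx0 : x = 0 := by linarith
      have hy0 : y = 0 := by linarith
      simp [hx0, hy0]
    · refine le_of_mul_le_mul_right ?_ h0
      calc |x - y| * (x + y) = |x ^ 2 - y ^ 2| := by
            rw [sq_sub_sq, abs_mul, abs_of_pos h0, mul_comm]
        _ = |x * t - y * s| * (x * t + y * s) := by rw [fac, abs_mul, abs_of_nonneg hu0]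
        _ ≤ |x * t - y * s| * (x + y) := by
            gcongr
            · exact mul_le_of_le_one_right hx ht1
            · exact mul_le_of_le_one_right hy hs1
  · refine le_trans ?_ hw
    rw [fac, abs_mul, abs_of_nonneg hu0]
    refine mul_le_of_le_one_right (abs_nonneg _) ?_
    nlinarith [sq_nonneg (x - t), sq_nonneg (y - s)]

/-- If `x, y, z` are cosines of angles `α, β, γ ∈ [0, π/2]` with `|α - β| ≤ γ`, then the `k`-th
powers with `k ≥ 2` obey the entry inequality. -/
theorem abs_rpow_sub_rpow_le {x y z k : ℝ} (hx : 0 ≤ x) (hy : 0 ≤ y) (hz : 0 ≤ z)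
    (hx1 : x ≤ 1) (hy1 : y ≤ 1) (hk : 2 ≤ k) (h : z ≤ x * y + √(1 - x ^ 2) * √(1 - y ^ 2)) :
    |x ^ k - y ^ k| ≤ √(1 - z ^ k) := by
  have half (u : ℝ) (hu : 0 ≤ u) : u ^ k = (u ^ (k / 2)) ^ 2 := by
    rw [← Real.rpow_natCast, ← Real.rpow_mul hu]; congr 1; push_cast; ring
  rw [half x hx, half y hy, half z hz]
  exact (abs_sub_le_and_abs_sq_sub_sq_le (by positivity) (by positivity) (by positivity)
    (Real.rpow_le_one hx hx1 (by linarith)) (Real.rpow_le_one hy hy1 (by linarith))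
    (rpow_le_of_le_mul_add_sqrt hx hy hz hx1 hy1 (by linarith) h)).2

/-! ### The angle condition in inner product spaces -/

/-- Split `b` and `c` along `a`: the orthogonal parts have the sines as norms, and Cauchy–Schwarz
bounds their inner product. -/
theorem norm_inner_le_mul_add_sqrt {𝕜 E : Type*} [RCLike 𝕜] [NormedAddCommGroup E]
    [InnerProductSpace 𝕜 E] {a b c : E} (ha : ‖a‖ = 1) (hb : ‖b‖ = 1) (hc : ‖c‖ = 1) :
    ‖inner 𝕜 b c‖ ≤ ‖inner 𝕜 a b‖ * ‖inner 𝕜 a c‖ +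
      √(1 - ‖inner 𝕜 a b‖ ^ 2) * √(1 - ‖inner 𝕜 a c‖ ^ 2) := by
  have comp (v : E) (hv : ‖v‖ = 1) :
      ‖v - inner 𝕜 a v • a‖ = √(1 - ‖inner 𝕜 a v‖ ^ 2) := by
    rw [eq_comm, Real.sqrt_eq_iff_eq_sq (by
      have := norm_inner_le_norm (𝕜 := 𝕜) a v
      rw [ha, hv] at this
      nlinarith [norm_nonneg (inner 𝕜 a v)]) (norm_nonneg _)]
    have orth : inner 𝕜 (v - inner 𝕜 a v • a) (inner 𝕜 a v • a) = 0 := by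
      simp [inner_sub_left, inner_smul_left, inner_smul_right, ha]
    have := norm_add_sq_eq_norm_sq_add_norm_sq_of_inner_eq_zero _ _ orth
    rw [sub_add_cancel, norm_smul, hv, ha] at this
    nlinarith
  have dec : inner 𝕜 b c = inner 𝕜 b a * inner 𝕜 a c +
      inner 𝕜 (b - inner 𝕜 a b • a) (c - inner 𝕜 a c • a) := by
    simp [inner_sub_left, inner_sub_right, inner_smul_left, inner_smul_right, ha]
  rw [← comp b hb, ← comp c hc, dec]
  refine (norm_add_le _ _).trans (add_le_add ?_ (norm_inner_le_norm _ _))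
  rw [norm_mul, norm_inner_symm b a]

/-! ### Polar decomposition and the trace norm -/

/-- Equal norms make `f v ↦ g v` a well-defined isometry on the range of `f`; finite dimension lets
it extend to `V`. -/
theorem LinearMap.exists_linearIsometry_comp_eq {𝕜 V : Type*} [RCLike 𝕜] [NormedAddCommGroup V]
    [InnerProductSpace 𝕜 V] [FiniteDimensional 𝕜 V] (f g : V →ₗ[𝕜] V) (h : ∀ v, ‖f v‖ = ‖g v‖) :
    ∃ L : V →ₗᵢ[𝕜] V, ∀ v, L (f v) = g v := by
  have hker : LinearMap.ker f ≤ LinearMap.ker g := fun v hv => by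
    rw [LinearMap.mem_ker] at hv ⊢
    rw [← norm_eq_zero, ← h, hv, norm_zero]
  let l : LinearMap.range f →ₗ[𝕜] V :=
    (LinearMap.ker f).liftQ g hker ∘ₗ f.quotKerEquivRange.symm.toLinearMap
  have hl (v : V) : l ⟨f v, LinearMap.mem_range_self f v⟩ = g v := by
    simp only [l, LinearMap.comp_apply, LinearEquiv.coe_coe]
    rw [LinearMap.quotKerEquivRange_symm_apply_image]
    simp
  let L : LinearMap.range f →ₗᵢ[𝕜] V := ⟨l, by
    rintro ⟨_, v, rfl⟩
    rw [hl, ← h]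
    rfl⟩
  exact ⟨L.extend, fun v =>
    (L.extend_apply ⟨f v, LinearMap.mem_range_self f v⟩).trans (hl v)⟩

namespace Matrix

/-- The entries of a matrix as a vector of the Euclidean space carrying the Frobenius norm. -/
noncomputable def entryVec {n : Type*} (A : Matrix n n ℂ) : EuclideanSpace ℂ (n × n) :=
  WithLp.toLp 2 fun p => A p.1 p.2

theorem inner_entryVec {n : Type*} [Fintype n] (A B : Matrix n n ℂ) :
    inner ℂ A.entryVec B.entryVec = (Aᴴ * B).trace := by
  simp [entryVec, PiLp.inner_apply, trace, mul_apply, Fintype.sum_prod_type, mul_comm]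
  exact Finset.sum_comm

theorem norm_entryVec_eq_one {n : Type*} [Fintype n] {A : Matrix n n ℂ}
    (h : (Aᴴ * A).trace = 1) : ‖A.entryVec‖ = 1 := by
  have := inner_self_eq_norm_sq_to_K (𝕜 := ℂ) A.entryVec
  rw [inner_entryVec, h] at this
  exact (pow_eq_one_iff_of_nonneg (norm_nonneg _) two_ne_zero).1
    (Complex.ofReal_injective (by simpa using this.symm))

theorem exists_unitary_mul_eq {n : Type*} [Fintype n] [DecidableEq n]
    (P X : Matrix n n ℂ) (h : Pᴴ * P = Xᴴ * X) :
    ∃ U : Matrix n n ℂ, Uᴴ * U = 1 ∧ U * P = X := by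
  have key (A : Matrix n n ℂ) (v : EuclideanSpace ℂ n) :
      ((‖toEuclideanLin A v‖ ^ 2 : ℝ) : ℂ) = inner ℂ v (toEuclideanLin (Aᴴ * A) v) := by
    have h1 := inner_self_eq_norm_sq_to_K (𝕜 := ℂ) (toEuclideanLin A v)
    rw [← LinearMap.adjoint_inner_right, ← toEuclideanLin_conjTranspose_eq_adjoint] at h1
    have h2 : toEuclideanLin (Aᴴ * A) v = toEuclideanLin Aᴴ (toEuclideanLin A v) := by
      simp [toLpLin_apply, mulVec_mulVec]
    rw [h2, h1]
    push_cast
    rfl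
  obtain ⟨L, hL⟩ := LinearMap.exists_linearIsometry_comp_eq (toEuclideanLin P) (toEuclideanLin X)
    (fun v => by
      have := (key P v).trans ((congrArg (fun M => inner ℂ v (toEuclideanLin M v)) h).trans
        (key X v).symm)
      have h2 : ‖toEuclideanLin P v‖ ^ 2 = ‖toEuclideanLin X v‖ ^ 2 := by exact_mod_cast this
      exact (sq_eq_sq₀ (norm_nonneg _) (norm_nonneg _)).1 h2)
  have hU := LinearEquiv.apply_symm_apply (toEuclideanLin (𝕜 := ℂ) (m := n) (n := n)) L.toLinearMap
  set U := (toEuclideanLin (𝕜 := ℂ) (m := n) (n := n)).symm L.toLinearMap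
  have hmul (A B : Matrix n n ℂ) (v : EuclideanSpace ℂ n) :
      toEuclideanLin (A * B) v = toEuclideanLin A (toEuclideanLin B v) := by
    simp [toLpLin_apply, mulVec_mulVec]
  refine ⟨U, ?_, ?_⟩
  · apply (toEuclideanLin (𝕜 := ℂ) (m := n) (n := n)).injective
    ext1 v
    refine ext_inner_left ℂ fun w => ?_
    rw [hmul, toEuclideanLin_conjTranspose_eq_adjoint, LinearMap.adjoint_inner_right, hU]
    simp
  · apply (toEuclideanLin (𝕜 := ℂ) (m := n) (n := n)).injective
    ext1 v
    rw [hmul, hU]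
    exact hL v
end Matrix

theorem matrixAbs_posSemidef {n : ℕ} (X : Matrix (Fin n) (Fin n) ℂ) : (matrixAbs X).PosSemidef :=
  Matrix.nonneg_iff_posSemidef.1 (CFC.sqrt_nonneg _)

theorem matrixAbs_mul_self {n : ℕ} (X : Matrix (Fin n) (Fin n) ℂ) :
    matrixAbs X * matrixAbs X = Xᴴ * X :=
  CFC.sqrt_mul_sqrt_self _ (Matrix.posSemidef_conjTranspose_mul_self X).nonneg

/-- Polar decomposition. -/
theorem exists_unitary_mul_matrixAbs {n : ℕ} (X : Matrix (Fin n) (Fin n) ℂ) :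
    ∃ U : Matrix (Fin n) (Fin n) ℂ, Uᴴ * U = 1 ∧ U * matrixAbs X = X :=
  Matrix.exists_unitary_mul_eq _ X (by
    rw [(matrixAbs_posSemidef X).isHermitian.eq, matrixAbs_mul_self])

/-- Attainment half of the variational formula for the trace norm; `norm_trace_unitary_mul_le` is
the upper bound. -/
theorem exists_unitary_trace_mul_eq {n : ℕ} (X : Matrix (Fin n) (Fin n) ℂ) :
    ∃ U : Matrix (Fin n) (Fin n) ℂ, Uᴴ * U = 1 ∧ (U * X).trace = (matrixAbs X).trace := by
  obtain ⟨U, hU, hX⟩ := exists_unitary_mul_matrixAbs X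
  refine ⟨Uᴴ, by rw [Matrix.conjTranspose_conjTranspose, mul_eq_one_comm.1 hU], ?_⟩
  rw [← Matrix.one_mul (matrixAbs X), ← hU, Matrix.mul_assoc, hX]

/-- With `X = U|X|` and `|X| = R Rᴴ`, the trace is the Frobenius inner product of `R` and `V U R`,
which have equal norms. -/
theorem norm_trace_unitary_mul_le {n : ℕ} (V X : Matrix (Fin n) (Fin n) ℂ) (hV : Vᴴ * V = 1) :
    ‖(V * X).trace‖ ≤ ‖(matrixAbs X).trace‖ := by
  obtain ⟨U, hU, hX⟩ := exists_unitary_mul_matrixAbs X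
  obtain ⟨R, hR⟩ : ∃ R : Matrix (Fin n) (Fin n) ℂ, matrixAbs X = R * Rᴴ := by
    obtain ⟨R, hR⟩ := CStarAlgebra.nonneg_iff_eq_star_mul_self.1 (matrixAbs_posSemidef X).nonneg
    exact ⟨Rᴴ, by rw [hR, Matrix.conjTranspose_conjTranspose]; rfl⟩
  have hW : (V * U)ᴴ * (V * U) = 1 := by
    rw [Matrix.conjTranspose_mul, Matrix.mul_assoc, ← Matrix.mul_assoc Vᴴ, hV, Matrix.one_mul, hU]
  have h1 : (V * X).trace = inner ℂ R.entryVec (V * U * R).entryVec := by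
    rw [Matrix.inner_entryVec, Matrix.trace_mul_comm Rᴴ, Matrix.mul_assoc, ← hR, Matrix.mul_assoc,
      hX]
  have h2 : inner ℂ (V * U * R).entryVec (V * U * R).entryVec = inner ℂ R.entryVec R.entryVec := by
    rw [Matrix.inner_entryVec, Matrix.inner_entryVec, Matrix.conjTranspose_mul, Matrix.mul_assoc,
      ← Matrix.mul_assoc (V * U)ᴴ, hW, Matrix.one_mul]
  have h3 : ‖(V * U * R).entryVec‖ = ‖R.entryVec‖ := by
    rw [norm_eq_sqrt_re_inner (𝕜 := ℂ), h2, ← norm_eq_sqrt_re_inner]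
  have h4 : (matrixAbs X).trace = inner ℂ R.entryVec R.entryVec := by
    rw [hR, Matrix.inner_entryVec, Matrix.trace_mul_comm]
  rw [h1, h4, inner_self_eq_norm_sq_to_K, norm_pow, RCLike.norm_ofReal, abs_norm, sq]
  exact (norm_inner_le_norm _ _).trans_eq (by rw [h3])

/-! ### From the angle condition to the three arrays -/

/-- The angle condition on the moduli of the entries implies the entry inequalities; it is enough
to have it after the smaller of the two entries of the first row is decreased. -/
theorem EntryInequalities.of_le {n : ℕ} {a : Fin n → Fin n → ℂ} (h1 : ∀ s t, ‖a s t‖ ≤ 1)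
    (h : ∀ i p q, ∃ x y : ℝ, 0 ≤ x ∧ 0 ≤ y ∧ x ≤ 1 ∧ y ≤ 1 ∧
      (x ≤ ‖a i p‖ ∧ ‖a i p‖ ≤ ‖a i q‖ ∧ y = ‖a i q‖ ∨
        y ≤ ‖a i q‖ ∧ ‖a i q‖ ≤ ‖a i p‖ ∧ x = ‖a i p‖) ∧
      ‖a p q‖ ≤ x * y + √(1 - x ^ 2) * √(1 - y ^ 2)) :
    EntryInequalities a := by
  intro i p q _ _
  obtain ⟨x, y, hx, hy, hx1, hy1, hxy, hz⟩ := h i p q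
  have hz0 := norm_nonneg (a p q)
  refine ⟨h1 p q, le_trans ?_ (abs_sub_le_and_abs_sq_sub_sq_le hx hy hz0 hx1 hy1 hz).1, ?_,
    fun k hk => le_trans ?_ (abs_rpow_sub_rpow_le hx hy hz0 hx1 hy1 hk hz)⟩
  · rcases hxy with ⟨h, h', rfl⟩ | ⟨h, h', rfl⟩
    · rw [abs_of_nonpos (by linarith), abs_of_nonpos (by linarith)]
      linarith
    · rw [abs_of_nonneg (by linarith), abs_of_nonneg (by linarith)]
      linarith
  · rw [← Real.sqrt_mul zero_le_two]
    refine Real.sqrt_le_sqrt ?_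
    nlinarith [h1 p q]
  · have hk0 : 0 ≤ k := by linarith
    rcases hxy with ⟨h, h', rfl⟩ | ⟨h, h', rfl⟩
    · have e := Real.rpow_le_rpow hx h hk0
      have e' := Real.rpow_le_rpow (norm_nonneg _) h' hk0
      rw [abs_of_nonpos (by linarith), abs_of_nonpos (by linarith)]
      linarith
    · have e := Real.rpow_le_rpow hy h hk0
      have e' := Real.rpow_le_rpow (norm_nonneg _) h' hk0
      rw [abs_of_nonneg (by linarith), abs_of_nonneg (by linarith)]
      linarith

theorem entryInequalities_inner {n : ℕ} {𝕜 E : Type*} [RCLike 𝕜] [NormedAddCommGroup E]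
    [InnerProductSpace 𝕜 E] (v : Fin n → E) (hv : ∀ i, ‖v i‖ = 1) {a : Fin n → Fin n → ℂ}
    (ha : ∀ s t, ‖a s t‖ = ‖inner 𝕜 (v s) (v t)‖) : EntryInequalities a := by
  have h1 (s t) : ‖a s t‖ ≤ 1 := by
    simpa [ha, hv] using norm_inner_le_norm (𝕜 := 𝕜) (v s) (v t)
  refine .of_le h1 fun i p q => ⟨‖a i p‖, ‖a i q‖, norm_nonneg _, norm_nonneg _, h1 _ _, h1 _ _,
    ?_, ?_⟩
  · rcases le_total ‖a i p‖ ‖a i q‖ with h | h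
    · exact .inl ⟨le_rfl, h, rfl⟩
    · exact .inr ⟨le_rfl, h, rfl⟩
  · simp only [ha]
    exact norm_inner_le_mul_add_sqrt (hv i) (hv p) (hv q)

/-- Three unit vectors of the Frobenius inner product obey the angle condition. -/
theorem norm_trace_le_mul_add_sqrt {n : ℕ} {A B C : Matrix (Fin n) (Fin n) ℂ}
    (hA : (Aᴴ * A).trace = 1) (hB : (Bᴴ * B).trace = 1) (hC : (Cᴴ * C).trace = 1) :
    ‖(Bᴴ * C).trace‖ ≤ ‖(Aᴴ * B).trace‖ * ‖(Aᴴ * C).trace‖ +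
      √(1 - ‖(Aᴴ * B).trace‖ ^ 2) * √(1 - ‖(Aᴴ * C).trace‖ ^ 2) := by
  simpa only [Matrix.inner_entryVec] using norm_inner_le_mul_add_sqrt (𝕜 := ℂ)
    (Matrix.norm_entryVec_eq_one hA) (Matrix.norm_entryVec_eq_one hB)
    (Matrix.norm_entryVec_eq_one hC)

theorem norm_trace_conjTranspose_mul_le_one {n : ℕ} {A B : Matrix (Fin n) (Fin n) ℂ}
    (hA : (Aᴴ * A).trace = 1) (hB : (Bᴴ * B).trace = 1) : ‖(Aᴴ * B).trace‖ ≤ 1 := by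
  simpa [Matrix.inner_entryVec, Matrix.norm_entryVec_eq_one hA, Matrix.norm_entryVec_eq_one hB]
    using norm_inner_le_norm (𝕜 := ℂ) A.entryVec B.entryVec

theorem entryInequalities_trace_matrixAbs {n : ℕ} (H : Fin n → Matrix (Fin n) (Fin n) ℂ)
    (hH : ∀ i, ((H i)ᴴ * H i).trace = 1) :
    EntryInequalities (fun s t => (matrixAbs ((H s)ᴴ * H t)).trace) := by
  have rot {U : Matrix (Fin n) (Fin n) ℂ} (hU : Uᴴ * U = 1) (s : Fin n) :
      ((H s * U)ᴴ * (H s * U)).trace = 1 := by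
    rw [Matrix.conjTranspose_mul, Matrix.mul_assoc, Matrix.trace_mul_comm, Matrix.mul_assoc,
      Matrix.mul_assoc, mul_eq_one_comm.1 hU, Matrix.mul_one, hH]
  have adj {U : Matrix (Fin n) (Fin n) ℂ} (hU : Uᴴ * U = 1) : Uᴴᴴ * Uᴴ = 1 := by
    rw [Matrix.conjTranspose_conjTranspose, mul_eq_one_comm.1 hU]
  have mul {U V : Matrix (Fin n) (Fin n) ℂ} (hU : Uᴴ * U = 1) (hV : Vᴴ * V = 1) :
      (U * V)ᴴ * (U * V) = 1 := by
    rw [Matrix.conjTranspose_mul, Matrix.mul_assoc, ← Matrix.mul_assoc Uᴴ, hU, Matrix.one_mul, hV]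
  have left (U A B : Matrix (Fin n) (Fin n) ℂ) : (A * Uᴴ)ᴴ * B = U * (Aᴴ * B) := by
    rw [Matrix.conjTranspose_mul, Matrix.conjTranspose_conjTranspose, Matrix.mul_assoc]
  have right (U A B : Matrix (Fin n) (Fin n) ℂ) : (Aᴴ * (B * U)).trace = (U * (Aᴴ * B)).trace := by
    rw [← Matrix.mul_assoc, Matrix.trace_mul_comm]
  refine .of_le (fun s t => ?_) fun i p q => ?_
  · obtain ⟨U, hU, e⟩ := exists_unitary_trace_mul_eq ((H s)ᴴ * H t)
    rw [← e, ← left]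
    exact norm_trace_conjTranspose_mul_le_one (rot (adj hU) s) (hH t)
  · obtain ⟨V, hV, eV⟩ := exists_unitary_trace_mul_eq ((H p)ᴴ * H q)
    rcases le_total ‖(matrixAbs ((H i)ᴴ * H p)).trace‖ ‖(matrixAbs ((H i)ᴴ * H q)).trace‖
      with hle | hle
    · obtain ⟨W, hW, eW⟩ := exists_unitary_trace_mul_eq ((H i)ᴴ * H q)
      -- `W` makes the larger entry `iq` exact and `V` the entry `pq`; the `ip` entry becomes a
      -- trace against the unitary `Vᴴ * W`.
      refine ⟨‖((H i * Wᴴ)ᴴ * (H p * Vᴴ)).trace‖, ‖((H i * Wᴴ)ᴴ * H q).trace‖,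
        norm_nonneg _, norm_nonneg _,
        norm_trace_conjTranspose_mul_le_one (rot (adj hW) i) (rot (adj hV) p),
        norm_trace_conjTranspose_mul_le_one (rot (adj hW) i) (hH q),
        .inl ⟨?_, hle, by rw [left, eW]⟩, ?_⟩
      · rw [right, left, ← Matrix.mul_assoc]
        exact norm_trace_unitary_mul_le _ _ (mul (adj hV) hW)
      · rw [← eV, ← left]
        exact norm_trace_le_mul_add_sqrt (rot (adj hW) i) (rot (adj hV) p) (hH q)
    · obtain ⟨W, hW, eW⟩ := exists_unitary_trace_mul_eq ((H i)ᴴ * H p)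
      -- Now `ip` must stay exact, so `V` rotates `H q` instead of `H p`.
      refine ⟨‖((H i * Wᴴ)ᴴ * H p).trace‖, ‖((H i * Wᴴ)ᴴ * (H q * V)).trace‖,
        norm_nonneg _, norm_nonneg _,
        norm_trace_conjTranspose_mul_le_one (rot (adj hW) i) (hH p),
        norm_trace_conjTranspose_mul_le_one (rot (adj hW) i) (rot hV q),
        .inr ⟨?_, hle, by rw [left, eW]⟩, ?_⟩
      · rw [right, left, ← Matrix.mul_assoc]
        exact norm_trace_unitary_mul_le _ _ (mul hV hW)
      · rw [← eV, ← right]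
        exact norm_trace_le_mul_add_sqrt (rot (adj hW) i) (hH p) (rot hV q)

theorem mainTheorem8 (n : ℕ) (G H : Fin n → Matrix (Fin n) (Fin n) ℂ)
    (hG : ∀ i, IsDensityMatrix (G i)) (hGH : ∀ i, G i = (H i)ᴴ * H i) :
    EntryInequalities (fun s t => ((H s)ᴴ * H t).trace) ∧
    EntryInequalities (fun s t => ((((H s)ᴴ * H t).trace.re : ℝ) : ℂ)) ∧
    EntryInequalities (fun s t => (matrixAbs ((H s)ᴴ * H t)).trace) := by
  have hH (i) : ((H i)ᴴ * H i).trace = 1 := by rw [← hGH]; exact (hG i).trace_eq_one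
  have hv (i) := Matrix.norm_entryVec_eq_one (hH i)
  refine ⟨entryInequalities_inner (𝕜 := ℂ) (fun i => (H i).entryVec) hv fun s t => ?_, ?_,
    entryInequalities_trace_matrixAbs H hH⟩
  · rw [Matrix.inner_entryVec]
  -- The real parts are the inner products of the same vectors over `ℝ`.
  · let _ := InnerProductSpace.rclikeToReal ℂ (EuclideanSpace ℂ (Fin n × Fin n))
    refine entryInequalities_inner (𝕜 := ℝ) (fun i => (H i).entryVec) hv fun s t => ?_
    rw [real_inner_eq_re_inner ℂ, Matrix.inner_entryVec, Complex.norm_real]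
    rfl
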